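/- An applicative structure is a set $A$ with a binary operation, written as juxtaposition and associated to the left. An extensional $\mathbf{BC^{\pm}I}$-algebra is an applicative structure $A$ with elements $\mathbf B,\mathbf C^+,\mathbf C^-,\mathbf I$ which, with $a\circ b:=\mathbf B\,a\,b$, satisfies, for all $a,b,c\in A$ and all choices of signs ($\star$ is an arbitrary sign, chosen independently; $\pm,\mp$ are linked): $\mathbf B\,a\,b\,c=a(b\,c)$; $\mathbf C^\star a\,b\,c=a\,c\,b$; $\mathbf I\,a=a$; $\mathbf C^+a\,b=\mathbf C^-a\,b$; $\mathbf B\,\mathbf I=\mathbf I$; $\mathbf C^\star\mathbf B\,\mathbf I=\mathbf I$; $(\mathbf B\mathbf B)\circ\mathbf B=(\mathbf C^\star\mathbf B\,\mathbf B)\circ(\mathbf B\circ\mathbf B)$; $\mathbf C^\pm\circ\mathbf C^\mp=\mathbf I$; $(\mathbf B\mathbf C^\pm)\circ(\mathbf B\circ\mathbf B)=(\mathbf C^\star\mathbf B\,\mathbf C^\pm)\circ(\mathbf B\circ\mathbf B)$; $(\mathbf B\mathbf C^\pm)\circ(\mathbf C^\pm\circ(\mathbf B\mathbf C^\pm))=\mathbf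 C^\pm\circ((\mathbf B\mathbf C^\pm)\circ\mathbf C^\pm)$; $(\mathbf B\mathbf B)\circ\mathbf C^\pm=\mathbf C^\pm\circ((\mathbf B\mathbf C^\pm)\circ\mathbf B)$. Put $a^\bullet:=\mathbf C^+\mathbf I\,a$, $\mathbf B^0:=\mathbf I$, $\mathbf B^{m+1}:=\mathbf B\circ\mathbf B^m$ and $I_A(m):=\{a^\bullet\circ\mathbf B^m\mid a\in A\}\subseteq A$ for $m\ge 0$. Let $B_n$ be the Artin braid group with generators $\sigma_1,\dots,\sigma_{n-1}$, let $|\cdot|:B_n\to S_n$ be the homomorphism with $|\sigma_i|=(i\;\,i{+}1)$, and write $s(i)=|s|(i)$. For $s\in B_k$, $s[j_1,\dots,j_k]\in B_{j_1+\dots+j_k}$ denotes $s$ with its $m$-th strand replaced by $j_m$ parallel strands (strands are numbered at the input end, on which the right-hand factor of a product acts), and $t_1\oplus\dots\oplus t_k$ denotes the block direct sum of braids. A braided operad is a (non-symmetric) operad $(P(n))_{n\ge0}$ of sets, with unit and associativity laws, together with right actions of $B_n$ on $P(n)$ such that, for $f\in P(k)$, $s\in B_k$, $g_i\in P(j_i)$,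 $t_i\in B_{j_i}$, $$(fs)(g_1,\dots,g_k)=\bigl(f(g_{s^{-1}(1)},\dots,g_{s^{-1}(k)})\bigr)\,s[j_1,\dots,j_k],$$ $$f(g_1t_1,\dots,g_kt_k)=\bigl(f(g_1,\dots,g_k)\bigr)(t_1\oplus\dots\oplus t_k).$$ It is closed, with $\mathbf{app}\in P(2)$, if for all $n\ge0$ and $p\in P(n+1)$ there is a unique $\lambda(p)\in P(n)$ with $\mathbf{app}(\lambda(p),\mathit{id})=p$. **Proposition.** Let $A$ be an extensional $\mathbf{BC^{\pm}I}$-algebra. Then $I_A=(I_A(m))_{m\ge 0}$ is a closed braided operad with the following structure: $\mathit{id}=\mathbf I$; for $g\in I_A(n)$ and $f_i\in I_A(k_i)$, $$g(f_1,\dots,f_n)=f_1\circ(\mathbf B\,f_2)\circ\dots\circ(\mathbf B^{n-1}f_n)\circ g;$$ for $f\in I_A(n)$ and $1\le i<n$, $f\,\sigma_i^{\pm1}=(\mathbf B^{i-1}\mathbf C^\pm)\circ f$; $\mathbf{app}=\mathbf B$; and $\lambda(t)=(t\,\mathbf I)^\bullet\circ\mathbf B^m$ for $t\in I_A(m+1)$.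 Moreover $a\mapsto a^\bullet$ is an isomorphism $A\cong I_A(0)$ of applicative structures with $\mathbf B,\mathbf C^+,\mathbf C^-,\mathbf I$, where $I_A(0)$ has application $\mathbf{app}(a,b)$ and the elements $\mathbf I=\lambda(\mathit{id})$, $\mathbf B=\lambda(\lambda(\lambda(\mathbf{app}(\mathit{id},\mathbf{app}))))$, $\mathbf C^\pm=\lambda(\lambda(\lambda(\mathbf{app}(\mathbf{app}(\mathit{id},\mathit{id}),\mathit{id})\,\sigma_2^{\pm1})))$. -/

import Mathlib

universe u

/-! ## Artin braid groups -/

/-- Artin's relations on the `n - 1` generators `σ₁, …, σₙ₋₁` (indexed from `0` here). -/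
def braidRels (n : ℕ) : Set (FreeGroup (Fin (n - 1))) :=
  {r | (∃ i j : Fin (n - 1), (i : ℕ) + 1 < j ∧
          r = FreeGroup.of i * FreeGroup.of j * (FreeGroup.of j * FreeGroup.of i)⁻¹) ∨
       (∃ i j : Fin (n - 1), (j : ℕ) = i + 1 ∧
          r = FreeGroup.of i * FreeGroup.of j * FreeGroup.of i *
            (FreeGroup.of j * FreeGroup.of i * FreeGroup.of j)⁻¹)}

/-- The Artin braid group on `n` strands (trivial for `n = 0, 1`). -/
abbrev BraidGroup (n : ℕ) : Type := PresentedGroup (braidRels n)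

namespace BraidGroup

/-- The generator crossing strands `i` and `i + 1` (strands are numbered from `0`);
by convention it is `1` when there is no strand `i + 1`. -/
def gen (n i : ℕ) : BraidGroup n :=
  if h : i + 1 < n then PresentedGroup.of ⟨i, by omega⟩ else 1

theorem gen_comm {n i j : ℕ} (h : i + 1 < j) : gen n i * gen n j = gen n j * gen n i := by
  unfold gen
  split_ifs with h1 h2
  · have := PresentedGroup.one_of_mem (rels := braidRels n)
      (x := FreeGroup.of ⟨i, by omega⟩ * FreeGroup.of ⟨j, by omega⟩ *
        (FreeGroup.of ⟨j, by omega⟩ * FreeGroup.of ⟨i, by omega⟩)⁻¹)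
      (Or.inl ⟨⟨i, by omega⟩, ⟨j, by omega⟩, h, rfl⟩)
    rw [map_mul, map_inv, mul_inv_eq_one, map_mul, map_mul] at this
    exact this
  all_goals simp

theorem gen_braid {n i : ℕ} (h : i + 2 < n) :
    gen n i * gen n (i + 1) * gen n i = gen n (i + 1) * gen n i * gen n (i + 1) := by
  unfold gen
  rw [dif_pos (by omega), dif_pos (by omega)]
  have := PresentedGroup.one_of_mem (rels := braidRels n)
      (x := FreeGroup.of ⟨i, by omega⟩ * FreeGroup.of ⟨i + 1, by omega⟩ *
          FreeGroup.of ⟨i, by omega⟩ *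
        (FreeGroup.of ⟨i + 1, by omega⟩ * FreeGroup.of ⟨i, by omega⟩ *
          FreeGroup.of ⟨i + 1, by omega⟩)⁻¹)
      (Or.inr ⟨⟨i, by omega⟩, ⟨i + 1, by omega⟩, rfl, rfl⟩)
  rw [map_mul, map_inv, mul_inv_eq_one, map_mul, map_mul, map_mul, map_mul] at this
  exact this

/-- A homomorphism out of the braid group, from images of the generators satisfying
Artin's relations. -/
def lift {n : ℕ} {G : Type*} [Group G] (φ : ℕ → G)
    (h1 : ∀ i j, i + 1 < j → j + 1 < n → φ i * φ j = φ j * φ i)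
    (h2 : ∀ i, i + 2 < n → φ i * φ (i + 1) * φ i = φ (i + 1) * φ i * φ (i + 1)) :
    BraidGroup n →* G :=
  PresentedGroup.toGroup (f := fun i : Fin (n - 1) => φ i) (by
    rintro r (⟨i, j, hij, rfl⟩ | ⟨i, j, hij, rfl⟩)
    · simp only [map_mul, map_inv, FreeGroup.lift_apply_of, mul_inv_eq_one]
      exact h1 i j hij (by omega)
    · simp only [map_mul, map_inv, FreeGroup.lift_apply_of, mul_inv_eq_one, hij]
      exact h2 i (by omega))

theorem lift_gen {n : ℕ} {G : Type*} [Group G] (φ : ℕ → G) (h1) (h2) {i : ℕ} (hi : i + 1 < n) :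
    lift (n := n) φ h1 h2 (gen n i) = φ i := by
  unfold gen lift
  rw [dif_pos hi]
  exact PresentedGroup.toGroup.of _

/-- The transposition `(i, i + 1)` of `Fin n` (the identity if `i + 1` is out of range). -/
def adjSwap (n i : ℕ) : Equiv.Perm (Fin n) :=
  if h : i + 1 < n then Equiv.swap ⟨i, by omega⟩ ⟨i + 1, h⟩ else 1

theorem adjSwap_val {n i : ℕ} (h : i + 1 < n) (x : Fin n) :
    (adjSwap n i x : ℕ) = if (x : ℕ) = i then i + 1 else if (x : ℕ) = i + 1 then i else x := by
  rw [adjSwap, dif_pos h, Equiv.swap_apply_def]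
  simp only [Fin.ext_iff]
  split_ifs <;> rfl

theorem adjSwap_comm {n i j : ℕ} (hij : i + 1 < j) (hj : j + 1 < n) :
    adjSwap n i * adjSwap n j = adjSwap n j * adjSwap n i := by
  ext x
  simp only [Equiv.Perm.mul_apply, adjSwap_val hj, adjSwap_val (show i + 1 < n by omega)]
  split_ifs <;> omega

theorem adjSwap_braid {n i : ℕ} (hi : i + 2 < n) :
    adjSwap n i * adjSwap n (i + 1) * adjSwap n i =
      adjSwap n (i + 1) * adjSwap n i * adjSwap n (i + 1) := by
  ext x
  simp only [Equiv.Perm.mul_apply, adjSwap_val (show i + 1 < n by omega),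
    adjSwap_val (show i + 1 + 1 < n by omega)]
  split_ifs <;> omega

/-- The homomorphism `B_n → S_n` sending `σ_i` to the transposition `(i, i + 1)`. -/
def toPerm (n : ℕ) : BraidGroup n →* Equiv.Perm (Fin n) :=
  lift (adjSwap n) (fun _ _ => adjSwap_comm) (fun _ => adjSwap_braid)

/-! ### Parallel strands -/

/-- In `B_N`: strand `o` passes across the `q` strands `o + 1, …, o + q` to position `o + q`,
each crossing being a positive generator.  In a product the rightmost factor comes first. -/
def strandCross (N o : ℕ) : ℕ → BraidGroup N
  | 0 => 1
  | q + 1 => gen N (o + q) * strandCross N o q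

/-- In `B_N`: the block of `p` parallel strands starting at position `o` crosses the adjacent
block of `q` parallel strands starting at position `o + p`, each crossing being positive. -/
def blockCross (N : ℕ) : ℕ → ℕ → ℕ → BraidGroup N
  | _, 0, _ => 1
  | o, p + 1, q => strandCross N o q * blockCross N (o + 1) p q

theorem strandCross_comm_hi {N o q i : ℕ} (h : o + q < i) :
    strandCross N o q * gen N i = gen N i * strandCross N o q := by
  induction q with
  | zero => simp [strandCross]
  | succ q ih =>
    rw [strandCross, mul_assoc, ih (by omega), ← mul_assoc, gen_comm (by omega), mul_assoc]

theorem strandCross_comm_lo {N o q i : ℕ} (h : i + 1 < o) :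
    strandCross N o q * gen N i = gen N i * strandCross N o q := by
  induction q with
  | zero => simp [strandCross]
  | succ q ih =>
    rw [strandCross, mul_assoc, ih, ← mul_assoc, ← gen_comm (by omega), mul_assoc]

theorem blockCross_comm_hi {N o p q i : ℕ} (h : o + p + q ≤ i) :
    blockCross N o p q * gen N i = gen N i * blockCross N o p q := by
  induction p generalizing o with
  | zero => simp [blockCross]
  | succ p ih =>
    rw [blockCross, mul_assoc, ih (by omega), ← mul_assoc, strandCross_comm_hi (by omega),
      mul_assoc]

theorem blockCross_comm_lo {N o p q i : ℕ} (h : i + 1 < o) :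
    blockCross N o p q * gen N i = gen N i * blockCross N o p q := by
  induction p generalizing o with
  | zero => simp [blockCross]
  | succ p ih =>
    rw [blockCross, mul_assoc, ih (by omega), ← mul_assoc, strandCross_comm_lo (by omega),
      mul_assoc]

theorem strandCross_two {N o r : ℕ} (h : o + r + 2 ≤ N) :
    strandCross N o r * strandCross N (o + 1) r * gen N o =
      gen N (o + r) * (strandCross N o r * strandCross N (o + 1) r) := by
  induction r with
  | zero => simp [strandCross]
  | succ r ih =>
    have e : o + 1 + r = o + r + 1 := by omega
    have c : strandCross N o r * gen N (o + r + 1) = gen N (o + r + 1) * strandCross N o r :=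
      strandCross_comm_hi (by omega)
    have b := gen_braid (n := N) (i := o + r) (by omega)
    have ih' := ih (by omega)
    simp only [strandCross, e]
    rw [show o + (r + 1) = o + r + 1 by omega]
    calc gen N (o + r) * strandCross N o r * (gen N (o + r + 1) * strandCross N (o + 1) r)
          * gen N o
        = gen N (o + r) * (strandCross N o r * gen N (o + r + 1)) * strandCross N (o + 1) r
          * gen N o := by group
      _ = gen N (o + r) * gen N (o + r + 1) *
          (strandCross N o r * strandCross N (o + 1) r * gen N o) := by rw [c]; group
      _ = (gen N (o + r) * gen N (o + r + 1) * gen N (o + r)) *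
          (strandCross N o r * strandCross N (o + 1) r) := by rw [ih']; group
      _ = gen N (o + r + 1) * gen N (o + r) * (gen N (o + r + 1) * strandCross N o r) *
          strandCross N (o + 1) r := by rw [b]; group
      _ = _ := by rw [← c]; group

theorem blockCross_gen {N o n r i : ℕ} (hi : i + 1 < n) (h : o + n + r ≤ N) :
    blockCross N o n r * gen N (o + i) = gen N (o + i + r) * blockCross N o n r := by
  induction n generalizing o i with
  | zero => omega
  | succ n ih =>
    cases i with
    | succ i =>
      rw [blockCross, mul_assoc, show o + (i + 1) = o + 1 + i by omega,
        ih (by omega) (by omega), ← mul_assoc, strandCross_comm_hi (by omega), mul_assoc]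
    | zero =>
      obtain ⟨m, rfl⟩ : ∃ m, n = m + 1 := ⟨n - 1, by omega⟩
      have c : blockCross N (o + 1 + 1) m r * gen N o = gen N o * blockCross N (o + 1 + 1) m r :=
        blockCross_comm_lo (by omega)
      have t := strandCross_two (N := N) (o := o) (r := r) (by omega)
      rw [blockCross, blockCross, Nat.add_zero o, mul_assoc, mul_assoc, c, ← mul_assoc, ← mul_assoc,
        t, mul_assoc, mul_assoc]

theorem blockCross_strandCross {N o n r : ℕ} (h : o + n + r ≤ N) {i q : ℕ} (hq : i + q < n) :
    blockCross N o n r * strandCross N (o + i) q =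
      strandCross N (o + i + r) q * blockCross N o n r := by
  induction q with
  | zero => simp [strandCross]
  | succ q ih =>
    rw [strandCross, strandCross, ← mul_assoc, add_assoc o i q, blockCross_gen (by omega) h,
      mul_assoc, ih (by omega), ← mul_assoc]
    congr 3
    omega

theorem blockCross_blockCross {N o n r : ℕ} (h : o + n + r ≤ N) {i p q : ℕ}
    (hq : i + p + q ≤ n) :
    blockCross N o n r * blockCross N (o + i) p q =
      blockCross N (o + i + r) p q * blockCross N o n r := by
  induction p generalizing i with
  | zero => simp [blockCross]
  | succ p ih =>
    rw [blockCross, blockCross, ← mul_assoc, blockCross_strandCross h (by omega), mul_assoc,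
      show o + i + 1 = o + (i + 1) by omega, ih (by omega), ← mul_assoc]
    congr 3
    omega

theorem blockCross_add (N o p q r : ℕ) :
    blockCross N o (p + q) r = blockCross N o p r * blockCross N (o + p) q r := by
  induction p generalizing o with
  | zero => simp [blockCross]
  | succ p ih =>
    rw [show p + 1 + q = p + q + 1 by omega, blockCross, blockCross, ih, mul_assoc,
      show o + 1 + p = o + (p + 1) by omega]

theorem blockCross_yangBaxter {N o p q r : ℕ} (h : o + p + q + r ≤ N) :
    blockCross N o q r * (blockCross N (o + q) p r * blockCross N o p q) =
      blockCross N (o + r) p q * (blockCross N o p r * blockCross N (o + p) q r) := by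
  rw [← mul_assoc, ← blockCross_add, ← blockCross_add, add_comm q p]
  have := blockCross_blockCross (N := N) (o := o) (n := p + q) (r := r) (by omega)
    (i := 0) (p := p) (q := q) (by omega)
  simpa using this

theorem strandCross_far {N o q o' q' : ℕ} (h : o + q < o') :
    strandCross N o q * strandCross N o' q' = strandCross N o' q' * strandCross N o q := by
  induction q' with
  | zero => simp [strandCross]
  | succ q' ih =>
    rw [strandCross, ← mul_assoc, strandCross_comm_hi (by omega), mul_assoc, ih, mul_assoc]

theorem strandCross_blockCross_far {N o q o' p' q' : ℕ} (h : o + q < o') :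
    strandCross N o q * blockCross N o' p' q' = blockCross N o' p' q' * strandCross N o q := by
  induction p' generalizing o' with
  | zero => simp [blockCross]
  | succ p' ih =>
    rw [blockCross, ← mul_assoc, strandCross_far h, mul_assoc, ih (by omega), mul_assoc]

theorem blockCross_far {N o p q o' p' q' : ℕ} (h : o + p + q ≤ o') :
    blockCross N o p q * blockCross N o' p' q' = blockCross N o' p' q' * blockCross N o p q := by
  induction p generalizing o with
  | zero => simp [blockCross]
  | succ p ih =>
    rw [blockCross, mul_assoc, ih (by omega), ← mul_assoc,
      strandCross_blockCross_far (by omega), mul_assoc]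

/-- `j_1 + … + j_i`: the position of the first strand of the block with (0-based) index `i`. -/
def offset {k : ℕ} (j : Fin k → ℕ) (i : ℕ) : ℕ :=
  ∑ l : Fin k, if (l : ℕ) < i then j l else 0

theorem offset_succ {k : ℕ} (j : Fin k → ℕ) {i : ℕ} (h : i < k) :
    offset j (i + 1) = offset j i + j ⟨i, h⟩ := by
  have : j ⟨i, h⟩ = ∑ l : Fin k, if l = ⟨i, h⟩ then j l else 0 := by simp
  rw [offset, offset, this, ← Finset.sum_add_distrib]
  refine Finset.sum_congr rfl fun l _ => ?_
  simp only [Fin.ext_iff]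
  split_ifs <;> omega

theorem offset_le {k : ℕ} (j : Fin k → ℕ) (i : ℕ) : offset j i ≤ ∑ l, j l := by
  refine Finset.sum_le_sum fun l _ => ?_
  split_ifs <;> omega

theorem offset_add_le {k : ℕ} (j : Fin k → ℕ) (i : Fin k) :
    offset j i + j i ≤ ∑ l, j l := by
  rw [← offset_succ j i.2]
  exact offset_le j _

theorem offset_swap {k : ℕ} (j : Fin k → ℕ) {a i : ℕ} (h : a + 1 ≠ i) :
    offset (fun l => j ((adjSwap k a).symm l)) i = offset j i := by
  unfold offset
  rw [← Equiv.sum_comp (adjSwap k a) (fun l => if (l : ℕ) < i then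
    j ((adjSwap k a).symm l) else 0)]
  refine Finset.sum_congr rfl fun l _ => ?_
  rw [Equiv.symm_apply_apply]
  congr 1
  unfold adjSwap
  split_ifs with h1
  · simp only [Equiv.swap_apply_def, Fin.ext_iff]
    split_ifs <;> simp_all <;> omega
  · simp

/-- Sizes of `k` consecutive blocks of strands, `N` strands in total. -/
abbrev BlockSizes (k N : ℕ) : Type := {j : Fin k → ℕ // ∑ i, j i = N}

/-- Permuting the blocks: the block at position `i` moves to position `s i`. -/
def BlockSizes.permute {k N : ℕ} (s : Equiv.Perm (Fin k)) (j : BlockSizes k N) :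
    BlockSizes k N :=
  ⟨fun i => j.1 (s.symm i), (Equiv.sum_comp s.symm j.1).trans j.2⟩

theorem BlockSizes.permute_permute {k N : ℕ} (s t : Equiv.Perm (Fin k)) (j : BlockSizes k N) :
    (j.permute s).permute t = j.permute (t * s) := rfl

theorem BlockSizes.permute_one {k N : ℕ} (j : BlockSizes k N) : j.permute 1 = j := rfl

/-- The size of the block with index `i` (`0` out of range). -/
def BlockSizes.size {k N : ℕ} (j : BlockSizes k N) (i : ℕ) : ℕ :=
  if h : i < k then j.1 ⟨i, h⟩ else 0

/-- The braid obtained from `σ_i` by replacing the strands by parallel strands, as prescribed by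
`j`: block `i` crosses block `i + 1`. -/
def cableGen {k N : ℕ} (i : ℕ) (j : BlockSizes k N) : BraidGroup N :=
  blockCross N (offset j.1 i) (j.size i) (j.size (i + 1))

/-- The permutation `(j, b) ↦ (σ_i j, σ_i[j] b)`. -/
def cablePerm (k N i : ℕ) : Equiv.Perm (BlockSizes k N × BraidGroup N) where
  toFun x := (x.1.permute (adjSwap k i), cableGen i x.1 * x.2)
  invFun x := (x.1.permute (adjSwap k i)⁻¹,
    (cableGen i (x.1.permute (adjSwap k i)⁻¹))⁻¹ * x.2)
  left_inv x := by
    simp [BlockSizes.permute_permute, BlockSizes.permute_one]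
  right_inv x := by
    simp [BlockSizes.permute_permute, BlockSizes.permute_one]

theorem size_permute {k N : ℕ} (j : BlockSizes k N) {a : ℕ} (h : a + 1 < k) (i : ℕ) :
    (j.permute (adjSwap k a)).size i =
      j.size (if i = a then a + 1 else if i = a + 1 then a else i) := by
  unfold BlockSizes.size BlockSizes.permute adjSwap
  simp only [dif_pos h, Equiv.symm_swap, Equiv.swap_apply_def, Fin.ext_iff]
  split_ifs <;> omega

theorem offset_succ_size {k N : ℕ} (j : BlockSizes k N) {i : ℕ} (h : i < k) :
    offset j.1 (i + 1) = offset j.1 i + j.size i := by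
  rw [offset_succ j.1 h, BlockSizes.size, dif_pos h]

theorem offset_permute {k N : ℕ} (j : BlockSizes k N) {a i : ℕ} (h : a + 1 ≠ i) :
    offset (j.permute (adjSwap k a)).1 i = offset j.1 i :=
  offset_swap j.1 h

/-- The homomorphism sending a braid `s` on `k` strands to the permutation
`(j, b) ↦ (s j, s[j] b)`, where `s[j]` is `s` with strand `m` replaced by `j m` parallel
strands. -/
def cableHom (k N : ℕ) : BraidGroup k →* Equiv.Perm (BlockSizes k N × BraidGroup N) :=
  lift (cablePerm k N)
    (by
      intro a b hab hb
      refine Equiv.ext fun x => ?_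
      obtain ⟨j, x⟩ := x
      have o1 := offset_permute j (a := b) (i := a) (by omega)
      have o2 := offset_permute j (a := a) (i := b) (by omega)
      have hle : offset j.1 a + j.size a + j.size (a + 1) ≤ offset j.1 b := by
        rw [← offset_succ_size j (by omega), ← offset_succ_size j (by omega)]
        refine Finset.sum_le_sum fun l _ => ?_
        split_ifs <;> omega
      refine Prod.ext (congrArg j.permute (adjSwap_comm hab hb)) ?_
      · simp only [Equiv.Perm.mul_apply, cablePerm, Equiv.coe_fn_mk, cableGen, o1, o2,
          size_permute j (show a + 1 < k by omega), size_permute j hb, ← mul_assoc]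
        rw [if_neg (by omega), if_neg (by omega), if_neg (by omega), if_neg (by omega),
          if_neg (by omega), if_neg (by omega), if_neg (by omega), if_neg (by omega),
          blockCross_far hle])
    (by
      intro a ha
      refine Equiv.ext fun x => ?_
      obtain ⟨j, x⟩ := x
      have h1 : a + 1 < k := by omega
      have h2 : a + 1 + 1 < k := by omega
      refine Prod.ext (congrArg j.permute (adjSwap_braid ha)) ?_
      have hle : offset j.1 a + j.size a + j.size (a + 1) + j.size (a + 1 + 1) ≤ N := by
        rw [← offset_succ_size j (by omega), ← offset_succ_size j (by omega),
          ← offset_succ_size j (by omega)]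
        exact (offset_le _ _).trans j.2.le
      have yb := blockCross_yangBaxter hle
      have ho : ∀ i : BlockSizes k N, ∀ b, a ≤ b →
          offset (i.permute (adjSwap k b)).1 a = offset i.1 a :=
        fun i b hb => offset_permute i (by omega)
      have s1 : ∀ i : BlockSizes k N, (i.permute (adjSwap k a)).size a = i.size (a + 1) :=
        fun i => by rw [size_permute i h1, if_pos rfl]
      have s2 : ∀ i : BlockSizes k N, (i.permute (adjSwap k a)).size (a + 1) = i.size a :=
        fun i => by rw [size_permute i h1, if_neg (by omega), if_pos rfl]
      have s3 : ∀ i : BlockSizes k N,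
          (i.permute (adjSwap k a)).size (a + 1 + 1) = i.size (a + 1 + 1) :=
        fun i => by rw [size_permute i h1, if_neg (by omega), if_neg (by omega)]
      have s4 : ∀ i : BlockSizes k N, (i.permute (adjSwap k (a + 1))).size a = i.size a :=
        fun i => by rw [size_permute i h2, if_neg (by omega), if_neg (by omega)]
      have s5 : ∀ i : BlockSizes k N,
          (i.permute (adjSwap k (a + 1))).size (a + 1) = i.size (a + 1 + 1) :=
        fun i => by rw [size_permute i h2, if_pos rfl]
      have s6 : ∀ i : BlockSizes k N,
          (i.permute (adjSwap k (a + 1))).size (a + 1 + 1) = i.size (a + 1) :=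
        fun i => by rw [size_permute i h2, if_neg (by omega), if_pos rfl]
      simp only [Equiv.Perm.mul_apply, cablePerm, Equiv.coe_fn_mk, cableGen,
        offset_succ_size _ (show a < k by omega), ho _ a le_rfl, ho _ (a + 1) (Nat.le_succ a),
        s1, s2, s3, s4, s5, s6]
      simp only [← mul_assoc] at yb ⊢
      rw [yb])

/-- `s[j_1, …, j_k]`: the braid `s` with strand `m` replaced by `j_m` parallel strands (deleted
if `j_m = 0`), the strands being numbered at the input end, on which the rightmost factor of a
product acts. -/
def cable {k : ℕ} (s : BraidGroup k) (j : Fin k → ℕ) : BraidGroup (∑ i, j i) :=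
  (cableHom k (∑ i, j i) s (⟨j, rfl⟩, 1)).2

theorem cableHom_apply {k N : ℕ} (s : BraidGroup k) (j : BlockSizes k N) (b : BraidGroup N) :
    cableHom k N s (j, b) = (j.permute (toPerm k s), (cableHom k N s (j, 1)).2 * b) := by
  have key : s ∈ Subgroup.closure (Set.range (PresentedGroup.of (rels := braidRels k))) := by
    rw [PresentedGroup.closure_range_of]; trivial
  induction key using Subgroup.closure_induction generalizing j b with
  | mem x hx =>
    obtain ⟨⟨i, hi⟩, rfl⟩ := hx
    have h : i + 1 < k := by omega
    have e : PresentedGroup.of (rels := braidRels k) ⟨i, hi⟩ = gen k i := by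
      rw [gen, dif_pos h]
    rw [e, cableHom, toPerm, lift_gen _ _ _ h, lift_gen _ _ _ h]
    simp [cablePerm]
  | one => simp [BlockSizes.permute_one]
  | mul x y _ _ hx hy =>
    rw [map_mul, map_mul, Equiv.Perm.mul_apply, Equiv.Perm.mul_apply, hy j b, hx, hy j 1,
      hx _ ((cableHom k N y (j, 1)).2 * 1), BlockSizes.permute_permute]
    simp [mul_assoc]
  | inv x _ hx =>
    have h : ∀ b, cableHom k N x⁻¹ (j, b) = (j.permute (toPerm k x)⁻¹,
        ((cableHom k N x (j.permute (toPerm k x)⁻¹, 1)).2)⁻¹ * b) := by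
      intro b
      rw [map_inv, Equiv.Perm.inv_eq_iff_eq, hx, BlockSizes.permute_permute]
      simp [BlockSizes.permute_one]
    rw [h b, h 1, map_inv]
    simp

/-- `(s t)[j] = s[t j] t[j]`. -/
theorem cable_mul {k N : ℕ} (s t : BraidGroup k) (j : BlockSizes k N) :
    (cableHom k N (s * t) (j, 1)).2 =
      (cableHom k N s (j.permute (toPerm k t), 1)).2 * (cableHom k N t (j, 1)).2 := by
  rw [map_mul, Equiv.Perm.mul_apply, cableHom_apply t j 1, cableHom_apply s _ (_ * 1), mul_one]

/-- `σ_i[j]` is the positive crossing of the blocks `i` and `i + 1`. -/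
theorem cable_gen {k i : ℕ} (h : i + 1 < k) (j : Fin k → ℕ) :
    cable (gen k i) j =
      blockCross _ (offset j i) (j ⟨i, by omega⟩) (j ⟨i + 1, h⟩) := by
  rw [cable, cableHom, lift_gen _ _ _ h]
  simp only [cablePerm, Equiv.coe_fn_mk, cableGen, BlockSizes.size, dif_pos h,
    dif_pos (show i < k by omega), mul_one]

/-- The inclusion `B_n → B_N` adding `o` strands before and `N - o - n` strands after. -/
def shift (o n N : ℕ) (h : o + n ≤ N) : BraidGroup n →* BraidGroup N :=
  lift (fun i => gen N (o + i))
    (fun _ _ hij _ => gen_comm (by omega))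
    (fun i hi => gen_braid (i := o + i) (by omega))

/-- The block direct sum `t_1 ⊕ ⋯ ⊕ t_k`. -/
def directSum {k : ℕ} {j : Fin k → ℕ} (t : ∀ m, BraidGroup (j m)) : BraidGroup (∑ m, j m) :=
  (List.ofFn fun m => shift (offset j m) (j m) _ (offset_add_le j m) (t m)).prod

end BraidGroup

/-! ## Operads -/

/-- Transport along an equality of arities. -/
def castArity {P : ℕ → Type u} {m n : ℕ} (h : m = n) (x : P m) : P n := h ▸ x

theorem sum_flatten {n : ℕ} (k : Fin n → ℕ) (l : ∀ i, Fin (k i) → ℕ) :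
    ∑ q : Fin (∑ i, k i), l (finSigmaFinEquiv.symm q).1 (finSigmaFinEquiv.symm q).2 =
      ∑ i, ∑ a, l i a := by
  rw [Equiv.sum_comp finSigmaFinEquiv.symm (fun x : (i : Fin n) × Fin (k i) => l x.1 x.2),
    Fintype.sum_sigma]

/-- A (planar, i.e. non-symmetric) operad with underlying family of sets `P`. -/
structure PlanarOperad (P : ℕ → Type u) where
  /-- the identity -/
  one : P 1
  /-- the composite `g(f_1, …, f_n)` -/
  comp : ∀ {n : ℕ} (_ : P n) {k : Fin n → ℕ} (_ : ∀ i, P (k i)), P (∑ i, k i)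
  comp_one : ∀ {n : ℕ} (f : P n), castArity (by simp) (comp f (fun _ => one)) = f
  one_comp : ∀ {n : ℕ} (f : P n),
    castArity (by simp) (comp one (k := fun _ => n) (fun _ => f)) = f
  /-- `h(g_1(f_11, …), …, g_n(f_n1, …)) = (h(g_1, …, g_n))(f_11, …)`; the list
  `f_11, f_12, …` is indexed lexicographically by `Fin (k_1 + ⋯ + k_n)`. -/
  assoc : ∀ {n : ℕ} (h : P n) {k : Fin n → ℕ} (g : ∀ i, P (k i))
    {l : ∀ i, Fin (k i) → ℕ} (f : ∀ i a, P (l i a)),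
    comp h (fun i => comp (g i) (f i)) =
      castArity (sum_flatten k l) (comp (comp h g)
        (fun q => f (finSigmaFinEquiv.symm q).1 (finSigmaFinEquiv.symm q).2))

/-- `f(x, y)` for a binary `f`. -/
def PlanarOperad.comp₂ {P : ℕ → Type u} (O : PlanarOperad P) (f : P 2) {m n : ℕ}
    (x : P m) (y : P n) : P (m + n) :=
  castArity (by simp) (O.comp f (k := ![m, n])
    (Fin.cons (α := fun i => P (![m, n] i)) x (Fin.cons y (fun i => i.elim0))))

/-- A braided operad: an operad with right actions of the braid groups satisfying the two
equivariance conditions.  A braid `s` acts on indices through its underlying permutation. -/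
structure BraidedOperad (P : ℕ → Type u) extends PlanarOperad P where
  /-- `f s` -/
  act : ∀ {n : ℕ}, P n → BraidGroup n → P n
  act_one : ∀ {n : ℕ} (f : P n), act f 1 = f
  act_mul : ∀ {n : ℕ} (f : P n) (s t : BraidGroup n), act f (s * t) = act (act f s) t
  /-- `(f s)(g_1, …, g_k) = (f(g_{s⁻¹(1)}, …, g_{s⁻¹(k)})) s[j_1, …, j_k]` -/
  act_comp : ∀ {k : ℕ} (f : P k) (s : BraidGroup k) {j : Fin k → ℕ} (g : ∀ i, P (j i)),
    comp (act f s) g =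
      act (castArity (Equiv.sum_comp (BraidGroup.toPerm k s)⁻¹ j)
        (comp f (fun i => g ((BraidGroup.toPerm k s)⁻¹ i)))) (s.cable j)
  /-- `f(g_1 t_1, …, g_k t_k) = (f(g_1, …, g_k)) (t_1 ⊕ ⋯ ⊕ t_k)` -/
  comp_act : ∀ {k : ℕ} (f : P k) {j : Fin k → ℕ} (g : ∀ i, P (j i))
    (t : ∀ i, BraidGroup (j i)),
    comp f (fun i => act (g i) (t i)) = act (comp f g) (BraidGroup.directSum t)

/-- A closed braided operad: there is `app` such that every `p` of arity `n + 1` is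
`app(q, id)` for a unique `q = lam p` of arity `n`. -/
structure ClosedBraidedOperad (P : ℕ → Type u) extends BraidedOperad P where
  app : P 2
  lam : ∀ {n : ℕ}, P (n + 1) → P n
  app_lam : ∀ {n : ℕ} (p : P (n + 1)), toPlanarOperad.comp₂ app (lam p) one = p
  lam_unique : ∀ {n : ℕ} (p : P (n + 1)) (q : P n),
    toPlanarOperad.comp₂ app q one = p → q = lam p

/-! ## Extensional `BC±I`-algebras -/

/-- The signs of `C⁺` and `C⁻`. -/
inductive BraidSign
  | pos
  | neg

/-- The opposite sign. -/
def BraidSign.flip : BraidSign → BraidSign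
  | pos => neg
  | neg => pos

/-- The exponent `1` or `-1`. -/
def BraidSign.toInt : BraidSign → ℤ
  | pos => 1
  | neg => -1

/-- An applicative structure with distinguished elements `B`, `C⁺`, `C⁻`, `I`. -/
class BCISignature (A : Type u) where
  app : A → A → A
  B : A
  C : BraidSign → A
  I : A

namespace BCISignature

/-- application -/
infixl:75 " ⬝ " => BCISignature.app

variable {A : Type u} [BCISignature A]

/-- `a ∘ b = B a b` -/
def circ (a b : A) : A := B ⬝ a ⬝ b

/-- composition -/
infixr:70 " ⊚ " => BCISignature.circ

/-- `a^• = C⁺ I a` -/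
def bullet (a : A) : A := C BraidSign.pos ⬝ I ⬝ a

/-- `Bᵐ = B ∘ ⋯ ∘ B` -/
def Bpow : ℕ → A
  | 0 => I
  | m + 1 => B ⊚ Bpow m

/-- `(Bⁱ f_1) ∘ (Bⁱ⁺¹ f_2) ∘ ⋯ ∘ g` -/
def compFrom : ℕ → List A → A → A
  | _, [], g => g
  | i, f :: fs, g => (Bpow i ⬝ f) ⊚ compFrom (i + 1) fs g

end BCISignature

open BCISignature in
/-- The axioms of extensional `BC±I`-algebras; `s` and `t` are arbitrary signs. -/
class ExtensionalBCI (A : Type u) [BCISignature A] : Prop where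
  B_app : ∀ a b c : A, B ⬝ a ⬝ b ⬝ c = a ⬝ (b ⬝ c)
  C_app : ∀ (s : BraidSign) (a b c : A), C s ⬝ a ⬝ b ⬝ c = a ⬝ c ⬝ b
  I_app : ∀ a : A, I ⬝ a = a
  C_two : ∀ a b : A, C BraidSign.pos ⬝ a ⬝ b = C BraidSign.neg ⬝ a ⬝ b
  lambda : (B : A) ⬝ I = I
  rho : ∀ s, (C s : A) ⬝ B ⬝ I = I
  alpha : ∀ s, (B ⬝ B : A) ⊚ B = (C s ⬝ B ⬝ B) ⊚ (B ⊚ B)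
  cox₁ : ∀ s, (C s : A) ⊚ C s.flip = I
  cox₂ : ∀ s t, (B ⬝ C s : A) ⊚ (B ⊚ B) = (C t ⬝ B ⬝ C s) ⊚ (B ⊚ B)
  cox₃ : ∀ s, (B ⬝ C s : A) ⊚ (C s ⊚ (B ⬝ C s)) = C s ⊚ ((B ⬝ C s) ⊚ C s)
  bc : ∀ s, (B ⬝ B : A) ⊚ C s = C s ⊚ ((B ⬝ C s) ⊚ B)

/-- `I_A(m) = {a^• ∘ Bᵐ | a ∈ A}`, the `m`-ary operators of the internal operad of `A`. -/
def internalOps (A : Type u) [BCISignature A] (m : ℕ) : Set A :=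
  {x | ∃ a : A, x = BCISignature.circ (BCISignature.bullet a) (BCISignature.Bpow m)}

/-- An isomorphism of applicative structures with `B`, `C⁺`, `C⁻`, `I`. -/
structure BCIIso (A A' : Type u) [BCISignature A] [BCISignature A'] extends A ≃ A' where
  map_app : ∀ a b : A, toFun (BCISignature.app a b) = BCISignature.app (toFun a) (toFun b)
  map_B : toFun BCISignature.B = BCISignature.B
  map_C : ∀ s, toFun (BCISignature.C s) = BCISignature.C s
  map_I : toFun BCISignature.I = BCISignature.I

/-- The set `P(0)` of a closed braided operad as an applicative structure: `a · b = app(a, b)`,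
`B = λ(λ(λ(app(id, app))))`, `C^± = λ(λ(λ(app(app(id, id), id) σ₂^±)))` (the combinators
`λfxy. f (x y)` and `λfxy. f y x` with its last two variables braided) and `I = λ(id)`. -/
abbrev ClosedBraidedOperad.nullary {P : ℕ → Type u} (O : ClosedBraidedOperad P) :
    BCISignature (P 0) where
  app a b := O.comp₂ O.app a b
  B := O.lam (n := 0) (O.lam (n := 1) (O.lam (n := 2) (O.comp₂ (m := 1) (n := 2) O.app O.one O.app)))
  C s := O.lam (n := 0) (O.lam (n := 1) (O.lam (n := 2)
    (O.act (O.comp₂ (m := 2) (n := 1) O.app (O.comp₂ (m := 1) (n := 1) O.app O.one O.one) O.one)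
      (BraidGroup.gen 3 1 ^ s.toInt))))
  I := O.lam (n := 0) O.one

/-! Composition makes `A` a monoid, and `a ↦ B a` is an endomorphism of it, so `raise i` shifts an
element past `i` inputs. The remaining axioms describe a strict braided category with objects the
natural numbers: `HasArity p q x` says, by a single equation between combinators, that `x` is a
morphism from `p` to `q`. Such equations are stable under composition and `raise`, and they imply
the sliding rule `HasArity.mul_raise`. `B` has type 1 → 2, `C s` has type 2 → 2 and `a^•` has type 1
→ 0.

The decisive point is the canonical form `HasArity.eq_bullet`: a morphism `x` from 1 to `m` equals
`(x I)^• ∘ Bᵐ`. Hence `I_A(m)` is exactly the set of such morphisms, and each is determined by its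
value at `I`. Closure under operadic composition follows from `hasArity_parallel`, associativity
from the interchange law `parallel_mul`, and closedness from reading the canonical form as
`app(λ(p), id) = p`.

The elements `Bⁱ C⁺` are units satisfying Artin's relations, which gives the action. Its
compatibility with direct sums is again sliding. Compatibility with cabling reduces to one generator
and two adjacent operators, `HasArity.mul_raise_mul_C`; by the canonical form this splits into rules
for a crossing meeting `B` (axiom `bc`) and meeting a bullet (`bullet_mul_C`, `raise_bullet_mul_C`).
Finally, `bullet_app` makes `a ↦ a^•` compatible with application, and nested abstractions are
computed by evaluating at `I`. -/

/-- `finSigmaFinEquiv` is lexicographic, as one sees by splitting off the last block. This matches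
the two ways of listing the inner operators in the associativity law. -/
theorem List.ofFn_finSigma {α : Type*} {n : ℕ} {k : Fin n → ℕ} (F : Fin (∑ i, k i) → α) :
    List.ofFn F =
      (List.ofFn fun i => List.ofFn fun a : Fin (k i) => F (finSigmaFinEquiv ⟨i, a⟩)).flatten := by
  induction n with
  | zero => simp
  | succ n ih =>
    rw [List.ofFn_congr (Fin.sum_univ_castSucc k), List.ofFn_add, List.ofFn_succ',
      List.concat_eq_append, List.flatten_append, ih]
    congr 1
    · congr 2
      funext i
      congr 1
      funext a
      congr 1
      ext
      simp [finSigmaFinEquiv_apply]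
    · simp only [List.flatten_cons, List.flatten_nil, List.append_nil]
      congr 1
      funext a
      congr 1
      ext
      simp only [Fin.val_cast, Fin.val_natAdd, finSigmaFinEquiv_apply]
      rfl

theorem coe_castArity {A : Type u} {S : ℕ → Set A} {m n : ℕ} (h : m = n) (x : S m) :
    ((castArity (P := fun m => S m) h x : S n) : A) = x := by
  subst h; rfl

namespace ExtensionalBCI

open BCISignature

variable {A : Type u} [BCISignature A] [ExtensionalBCI A]

/-! ### The monoid of a `BC±I`-algebra -/

/-- Axiom `alpha` evaluated at `a` and `b`; one further argument yields associativity of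
composition. -/
theorem B_circ_app (a b : A) : (B ⬝ (a ⊚ b) : A) = (B ⬝ a) ⊚ (B ⬝ b) := by
  have h := congrArg (fun x : A => x ⬝ a ⬝ b) (alpha (A := A) BraidSign.pos)
  simpa only [circ, B_app, C_app] using h

theorem circ_assoc (a b c : A) : (a ⊚ b) ⊚ c = a ⊚ (b ⊚ c) := by
  have h := congrArg (fun x : A => x ⬝ c) (B_circ_app a b)
  simpa only [circ, B_app] using h

/-- Composition makes a `BC±I`-algebra a monoid. -/
abbrev circMonoid (A : Type u) [BCISignature A] [ExtensionalBCI A] : Monoid A where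
  mul := circ
  one := BCISignature.I
  mul_assoc := circ_assoc
  one_mul a := by
    change B ⬝ BCISignature.I ⬝ a = a
    rw [lambda, I_app]
  mul_one a := by
    change B ⬝ a ⬝ BCISignature.I = a
    rw [← C_app BraidSign.pos B BCISignature.I a, rho, I_app]

attribute [local instance] circMonoid

theorem circ_eq_mul (a b : A) : a ⊚ b = a * b := rfl

theorem mul_app (a b c : A) : (a * b) ⬝ c = a ⬝ (b ⬝ c) := B_app a b c

theorem one_app (a : A) : (1 : A) ⬝ a = a := I_app a

theorem B_app_app (a b : A) : B ⬝ a ⬝ b = a * b := rfl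

theorem Bpow_eq_pow (m : ℕ) : (Bpow m : A) = B ^ m := by
  induction m with
  | zero => rfl
  | succ m ih => rw [Bpow, ih, circ_eq_mul, pow_succ']

/-- The endomorphism `a ↦ Bⁱ a` of the monoid of a `BC±I`-algebra. -/
def raise (i : ℕ) : A →* A where
  toFun a := (B ^ i : A) ⬝ a
  map_one' := by
    induction i with
    | zero => rw [pow_zero, one_app]
    | succ i ih => rw [pow_succ', mul_app, ih]; exact lambda
  map_mul' a b := by
    induction i with
    | zero => simp only [pow_zero, one_app]
    | succ i ih => simp only [pow_succ', mul_app, ih]; exact B_circ_app _ _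

theorem Bpow_app (i : ℕ) (a : A) : Bpow i ⬝ a = raise i a := by rw [Bpow_eq_pow]; rfl

theorem raise_zero (a : A) : raise 0 a = a := one_app a

theorem raise_one (a : A) : raise 1 a = B ⬝ a := by
  change (B ^ 1 : A) ⬝ a = _
  rw [pow_one]

theorem raise_raise (i j : ℕ) (a : A) : raise i (raise j a) = raise (i + j) a := by
  change (B ^ i : A) ⬝ ((B ^ j : A) ⬝ a) = (B ^ (i + j) : A) ⬝ a
  rw [pow_add, mul_app]

theorem B_mul_raise (a : A) : B * raise 1 a = raise 2 a * B := by
  have h := congrArg (fun x : A => x ⬝ a) (alpha (A := A) BraidSign.pos)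
  simp only [circ, B_app, C_app] at h
  rw [← raise_raise 1 1]
  simp only [raise_one]
  exact h

theorem C_mul_raise (s : BraidSign) (a : A) : C s * raise 2 a = raise 2 a * C s := by
  have h := congrArg (fun x : A => x ⬝ a) (cox₂ (A := A) s BraidSign.pos)
  simp only [circ, B_app, C_app] at h
  rw [← raise_raise 1 1]
  simp only [raise_one]
  exact h

theorem C_flip_mul_C (s : BraidSign) : (C s.flip : A) * C s = 1 := by
  cases s
  · exact cox₁ BraidSign.neg
  · exact cox₁ BraidSign.pos

theorem C_braid (s : BraidSign) :
    raise 1 (C s : A) * (C s * raise 1 (C s)) = C s * (raise 1 (C s) * C s) := by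
  simp only [raise_one]; exact cox₃ s

theorem raise_B_mul_C (s : BraidSign) :
    raise 1 (B : A) * C s = C s * (raise 1 (C s) * B) := by
  simp only [raise_one]; exact bc s

/-! ### Calculus of the elements `a^•` -/

theorem C_two_sign (s t : BraidSign) (a b : A) : C s ⬝ a ⬝ b = C t ⬝ a ⬝ b := by
  cases s <;> cases t <;> first | rfl | exact C_two a b | exact (C_two a b).symm

theorem C_flip_app_C_app (s : BraidSign) (a : A) : C s.flip ⬝ (C s ⬝ a) = a := by
  rw [← mul_app, C_flip_mul_C, one_app]

theorem B_mul_C_app (s : BraidSign) (a : A) : B * (C s ⬝ a) = C s ⬝ (C s * (B ⬝ a)) := by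
  have h := congrArg (fun x : A => x ⬝ a) (bc (A := A) s)
  simp only [circ, B_app] at h
  exact h

/-- The case `a = I` of `B_mul_C_app`, where `B I = I` removes the factor on the right, then applied
to `a`. -/
theorem B_app_bullet (s : BraidSign) (a : A) : B ⬝ bullet a = C s ⬝ C s ⬝ a := by
  have h := congrArg (fun x : A => x ⬝ a) (B_mul_C_app s (1 : A))
  rw [mul_app, ← raise_one (1 : A), map_one, mul_one] at h
  rw [← h, bullet, C_two_sign BraidSign.pos s]
  rfl

theorem bullet_mul (s : BraidSign) (a b : A) : bullet a * b = C s ⬝ b ⬝ a := by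
  rw [← B_app_app, B_app_bullet s, C_app]

/-- A nullary operator has no outgoing strand, so a crossing with it only changes its position. -/
theorem bullet_mul_C (s : BraidSign) (a : A) : bullet a * C s = raise 1 (bullet a) := by
  rw [raise_one, B_app_bullet s, bullet_mul s]

/-- Naturality of `C⁺` evaluated at `I` and `a`: the sliding rule for a morphism 1 → 0. -/
theorem bullet_mul_raise (a b : A) : bullet a * raise 1 b = b * bullet a := by
  have h := congrArg (fun x : A => x ⬝ 1 ⬝ a) (C_mul_raise BraidSign.pos b)
  rw [← raise_raise 1 1] at h
  simp only [mul_app, raise_one, B_app_app, mul_one] at h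
  rw [bullet_mul BraidSign.pos, raise_one]
  exact h

theorem bullet_one_mul_B : bullet (1 : A) * B = 1 := by
  rw [bullet_mul BraidSign.pos]; exact rho _

/-- The two signs must be mixed here: `C⁺` and `C⁻` are mutually inverse, so outer occurrences of
one can be cancelled by the other, and `C_two` identifies them again once two arguments are present.
-/
theorem bullet_app (a b : A) : bullet (a ⬝ b) = bullet b * (bullet a * B) := by
  have k : C BraidSign.pos ⬝ ((C BraidSign.neg ⬝ (1 : A)) * a) = C BraidSign.neg ⬝ B ⬝ a := by
    -- At `C⁻ I` the left side of `B_mul_C_app` collapses to `B`, because `C⁺ (C⁻ I) = I`; applying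
    -- `C⁻` then strips the outer `C⁺` on the right.
    have e := congrArg (fun x : A => C BraidSign.neg ⬝ x ⬝ a)
      (B_mul_C_app BraidSign.pos (C BraidSign.neg ⬝ (1 : A)))
    have h1 : C BraidSign.pos ⬝ (C BraidSign.neg ⬝ (1 : A)) = 1 :=
      C_flip_app_C_app BraidSign.neg _
    have h2 := C_flip_app_C_app BraidSign.pos
      (C BraidSign.pos * (B ⬝ (C BraidSign.neg ⬝ (1 : A))))
    simp only [BraidSign.flip] at h2
    simp only [h1, mul_one, h2, mul_app, B_app_app] at e
    exact e.symm
  have e : (C BraidSign.neg ⬝ (1 : A)) * a = C BraidSign.neg ⬝ (C BraidSign.neg ⬝ B ⬝ a) := by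
    rw [← k]; exact (C_flip_app_C_app BraidSign.pos _).symm
  have e' := congrArg (fun x : A => x ⬝ b) e
  simp only [mul_app] at e'
  rw [bullet_mul BraidSign.neg a, bullet_mul BraidSign.neg b, ← e', bullet]
  exact C_two _ _

/-! ### Arities -/

/-- Right composition, as an element of the algebra. -/
def rcomp (a : A) : A := bullet a * B

theorem rcomp_eq (s : BraidSign) (a : A) : rcomp a = C s ⬝ B ⬝ a := bullet_mul s a B

theorem rcomp_app (a b : A) : rcomp a ⬝ b = b * a := by
  rw [rcomp_eq BraidSign.pos, C_app, B_app_app]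

theorem rcomp_one : rcomp (1 : A) = 1 := bullet_one_mul_B

theorem bullet_app_eq (a b : A) : bullet (a ⬝ b) = bullet b * rcomp a := bullet_app a b

theorem rcomp_app_right (a b : A) : rcomp (a ⬝ b) = bullet b * rcomp a * B := by
  rw [rcomp, bullet_app_eq]

theorem raise_B_mul_B : raise 1 (B : A) * B = rcomp B * B ^ 2 := by
  rw [raise_one, rcomp_eq BraidSign.pos, pow_two]
  exact alpha BraidSign.pos

theorem raise_C_mul_B (s : BraidSign) : raise 1 (C s : A) * B ^ 2 = rcomp (C s) * B ^ 2 := by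
  rw [raise_one, rcomp_eq BraidSign.pos, pow_two]
  exact cox₂ s BraidSign.pos

theorem B_mul_bullet (a : A) : B * bullet a = bullet a * raise 1 B := (bullet_mul_raise a B).symm

/-- Expanding `B a b` by `rcomp_app_right` leaves `rcomp B * B ^ 2`, which `alpha` turns into `raise
1 B * B`; then `bullet a` slides past the raised `B`. -/
theorem rcomp_mul (a b : A) : rcomp (a * b) = rcomp b * rcomp a := by
  have h : (a * b : A) = B ⬝ a ⬝ b := rfl
  calc rcomp (a * b) = bullet b * (bullet a * (rcomp B * B ^ 2)) := by
        rw [h, rcomp_app_right, rcomp_app_right]; simp only [mul_assoc, pow_two]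
    _ = rcomp b * rcomp a := by
        rw [← raise_B_mul_B, ← mul_assoc (bullet a), ← B_mul_bullet]
        simp only [rcomp, mul_assoc]

/-- Associativity without its middle variable: composing on the left and on the right commute. -/
theorem raise_mul_rcomp (a b : A) : raise 1 a * rcomp b = rcomp b * raise 1 a := by
  rw [rcomp, mul_assoc, B_mul_raise, ← mul_assoc, ← mul_assoc, ← raise_raise 1 1,
    bullet_mul_raise]

/-- `x` is natural from `Bᵖ` to `B^q`, stated by combinators: it yields
`x ∘ (Bᵖ y) = (B^q y) ∘ x` for all `y`. For `p = 1` these are the `q`-ary operators. -/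
def HasArity (p q : ℕ) (x : A) : Prop := raise 1 x * B ^ p = rcomp x * B ^ q

theorem HasArity.mul_raise {p q : ℕ} {x : A} (h : HasArity p q x) (y : A) :
    x * raise p y = raise q y * x := by
  have h := congrArg (fun z : A => z ⬝ y) h
  simp only [mul_app, rcomp_app, raise_one] at h
  exact h

theorem HasArity.one (p : ℕ) : HasArity p p (1 : A) := by
  rw [HasArity, map_one, rcomp_one]

theorem HasArity.mul {p q r : ℕ} {x y : A} (hx : HasArity q r x) (hy : HasArity p q y) :
    HasArity p r (x * y) := by
  rw [HasArity, map_mul, mul_assoc, hy, ← mul_assoc, raise_mul_rcomp, mul_assoc, hx, rcomp_mul,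
    mul_assoc]

theorem HasArity.add {p q : ℕ} {x : A} (h : HasArity p q x) (r : ℕ) :
    HasArity (p + r) (q + r) x := by
  rw [HasArity, pow_add, pow_add, ← mul_assoc, h, mul_assoc]

/-- Naturality of `B` brings one `B` to the front, where the hypothesis applies; `alpha` then
reassembles `rcomp` of the raised element. -/
theorem HasArity.map_raise_one {p q : ℕ} {x : A} (h : HasArity p q x) :
    HasArity (p + 1) (q + 1) (raise 1 x) := by
  calc raise 1 (raise 1 x) * B ^ (p + 1)
      = raise 2 x * B * B ^ p := by rw [raise_raise, pow_succ', mul_assoc]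
    _ = B * (raise 1 x * B ^ p) := by rw [← B_mul_raise, mul_assoc]
    _ = B * bullet x * (B * B ^ q) := by rw [h, rcomp]; simp only [mul_assoc]
    _ = bullet x * (raise 1 B * B) * B ^ q := by rw [B_mul_bullet]; simp only [mul_assoc]
    _ = rcomp (raise 1 x) * B ^ (q + 1) := by
      rw [raise_B_mul_B, raise_one, rcomp_app_right, pow_two, pow_succ']
      simp only [mul_assoc]

theorem HasArity.map_raise {p q : ℕ} {x : A} (h : HasArity p q x) (i : ℕ) :
    HasArity (i + p) (i + q) (raise i x) := by
  induction i with
  | zero => simpa [raise_zero] using h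
  | succ i ih =>
    have := ih.map_raise_one
    rwa [raise_raise, add_comm 1 i, add_right_comm i p, add_right_comm i q] at this

theorem hasArity_B : HasArity 1 2 (B : A) := by
  rw [HasArity, pow_one, raise_B_mul_B]

theorem hasArity_B_pow (m : ℕ) : HasArity 1 (m + 1) (B ^ m : A) := by
  induction m with
  | zero => simpa using HasArity.one (A := A) 1
  | succ m ih =>
    rw [pow_succ']
    have := (hasArity_B (A := A)).add m
    rw [add_comm 1 m, add_comm 2 m] at this
    exact this.mul ih

/-! ### The canonical form of an `m`-ary operator -/

theorem hasArity_C (s : BraidSign) : HasArity 2 2 (C s : A) := raise_C_mul_B s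

/-- The arity equation of `C s` multiplied on the left by `I^•`, which is a left inverse of `B`.
This is the canonical form of the binary operator `C s ∘ B`. -/
theorem C_mul_B (s : BraidSign) : (C s : A) * B = bullet (C s ⬝ 1) * B ^ 2 := by
  have h := congrArg (fun x : A => bullet 1 * x) (raise_C_mul_B (A := A) s)
  simp only [← mul_assoc, bullet_mul_raise, ← bullet_app_eq] at h
  rw [← h, pow_two, mul_assoc (C s : A), ← mul_assoc (bullet (1 : A)), bullet_one_mul_B, one_mul]

theorem hasArity_bullet (a : A) : HasArity 1 0 (bullet a) := by
  rw [HasArity, pow_one, pow_zero, mul_one, ← bullet_mul_C BraidSign.pos, mul_assoc, C_mul_B,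
    rcomp, pow_two]
  have : bullet (bullet a) = bullet a * (bullet (C BraidSign.pos ⬝ 1) * B) := bullet_app _ _
  rw [this]
  simp only [mul_assoc]

/-- Since `(x I)^• = I^• ∘ rcomp x`, the arity equation turns the right side into `I^• ∘ (B x) ∘ B`;
sliding gives `x ∘ I^• ∘ B = x`. -/
theorem HasArity.eq_bullet {m : ℕ} {x : A} (h : HasArity 1 m x) : x = bullet (x ⬝ 1) * B ^ m := by
  rw [bullet_app_eq, mul_assoc, ← h, pow_one, ← mul_assoc, bullet_mul_raise, mul_assoc,
    bullet_one_mul_B, mul_one]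

theorem hasArity_bullet_mul_pow (a : A) (m : ℕ) : HasArity 1 m (bullet a * B ^ m) := by
  have := (hasArity_bullet a).add m
  rw [add_comm, zero_add] at this
  exact this.mul (hasArity_B_pow m)

theorem bullet_mul_pow_app_one (a : A) (m : ℕ) : (bullet a * B ^ m) ⬝ 1 = a := by
  have h : (B ^ m : A) ⬝ 1 = 1 := map_one (raise (A := A) m)
  rw [mul_app, h, bullet, C_app]
  exact (congrArg (· ⬝ a) (I_app 1)).trans (I_app a)

theorem mem_internalOps {m : ℕ} {x : A} : x ∈ internalOps A m ↔ HasArity 1 m x := by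
  constructor
  · rintro ⟨a, rfl⟩
    rw [Bpow_eq_pow]
    exact hasArity_bullet_mul_pow a m
  · intro h
    refine ⟨x ⬝ 1, ?_⟩
    rw [Bpow_eq_pow]
    exact h.eq_bullet

/-! ### Parallel composition -/

/-- `f_1 ∘ (B f_2) ∘ (B² f_3) ∘ ⋯`: the elements `f_i` side by side. -/
def parallel : List A → A
  | [] => 1
  | f :: fs => f * raise 1 (parallel fs)

theorem compFrom_eq (i : ℕ) (l : List A) (g : A) : compFrom i l g = raise i (parallel l) * g := by
  induction l generalizing i with
  | nil => rw [compFrom, parallel, map_one, one_mul]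
  | cons f l ih =>
    rw [compFrom, ih, parallel, map_mul, raise_raise, Bpow_app, circ_eq_mul, mul_assoc]

theorem parallel_append (l m : List A) :
    parallel (l ++ m) = parallel l * raise l.length (parallel m) := by
  induction l with
  | nil => simp [parallel, raise_zero]
  | cons f l ih =>
    rw [List.cons_append, parallel, ih, parallel, map_mul, raise_raise, mul_assoc, add_comm 1]
    rfl

theorem parallel_replicate_one (n : ℕ) : parallel (List.replicate n (1 : A)) = 1 := by
  induction n with
  | zero => rfl
  | succ n ih => rw [List.replicate_succ, parallel, ih, map_one, mul_one]

theorem hasArity_parallel {n : ℕ} {k : Fin n → ℕ} {g : Fin n → A}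
    (h : ∀ i, HasArity 1 (k i) (g i)) : HasArity n (∑ i, k i) (parallel (List.ofFn g)) := by
  induction n with
  | zero => simpa [parallel] using HasArity.one (A := A) 0
  | succ n ih =>
    rw [List.ofFn_succ, parallel, Fin.sum_univ_succ]
    have h1 := (ih fun i => h i.succ).map_raise 1
    have h2 := ((h 0).add (∑ i : Fin n, k i.succ)).mul h1
    rwa [add_comm 1 n] at h2

/-- The interchange law: each `g i` slides to the right past everything placed after it, and its
arity is exactly the shift needed to concatenate the lists. -/
theorem parallel_mul {n : ℕ} (F : Fin n → List A) {g : Fin n → A}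
    (h : ∀ i, HasArity 1 (F i).length (g i)) :
    parallel (List.ofFn fun i => parallel (F i) * g i) =
      parallel (List.ofFn F).flatten * parallel (List.ofFn g) := by
  induction n with
  | zero => simp [parallel]
  | succ n ih =>
    rw [List.ofFn_succ, parallel, ih (fun i => F i.succ) fun i => h i.succ, List.ofFn_succ,
      List.flatten_cons, parallel_append, List.ofFn_succ, parallel, map_mul, mul_assoc, mul_assoc,
      ← mul_assoc (g 0), (h 0).mul_raise, mul_assoc]

/-! ### The action of the braid groups -/

/-- `Bⁱ C⁺`, with inverse `Bⁱ C⁻`. -/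
def crossing (i : ℕ) : Aˣ :=
  Units.map (raise i) ⟨C BraidSign.pos, C BraidSign.neg, cox₁ BraidSign.pos,
    cox₁ BraidSign.neg⟩

/-- Sliding with equal source and target: elements acting on disjoint groups of strands commute. -/
theorem HasArity.commute {p : ℕ} {x : A} (h : HasArity p p x) (y : A) {i j : ℕ} (hij : i + p ≤ j) :
    raise i x * raise j y = raise j y * raise i x := by
  obtain ⟨d, rfl⟩ := Nat.exists_eq_add_of_le hij
  rw [← raise_raise, ← raise_raise, ← map_mul, h.mul_raise, map_mul]

/-- The right action of the braid groups, as a homomorphism to the opposite group. -/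
def braidHom (n : ℕ) : BraidGroup n →* (Aˣ)ᵐᵒᵖ :=
  BraidGroup.lift (fun i => MulOpposite.op (crossing i))
    (fun i j hij _ => by
      rw [← MulOpposite.op_mul, ← MulOpposite.op_mul]
      exact congrArg _ (Units.ext ((hasArity_C _).commute _ hij).symm))
    (fun i _ => by
      simp only [← MulOpposite.op_mul]
      refine congrArg _ (Units.ext ?_)
      have h := congrArg (raise i) (C_braid (A := A) BraidSign.pos)
      simp only [map_mul, raise_raise] at h
      exact h.symm)

/-- The element by which a braid acts on operators, by composition. -/
def braid (n : ℕ) (s : BraidGroup n) : A := ((braidHom n s).unop : Aˣ)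

theorem braid_one (n : ℕ) : (braid n 1 : A) = 1 := by simp [braid]

theorem braid_mul {n : ℕ} (s t : BraidGroup n) : (braid n (s * t) : A) = braid n t * braid n s := by
  simp [braid]

theorem braid_mul_inv {n : ℕ} (s : BraidGroup n) : (braid n s * braid n s⁻¹ : A) = 1 := by
  rw [← braid_mul, inv_mul_cancel, braid_one]

theorem braid_inv_mul {n : ℕ} (s : BraidGroup n) : (braid n s⁻¹ * braid n s : A) = 1 := by
  rw [← braid_mul, mul_inv_cancel, braid_one]

theorem braid_gen {n i : ℕ} (h : i + 1 < n) (s : BraidSign) :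
    (braid n (BraidGroup.gen n i ^ s.toInt) : A) = raise i (C s) := by
  rw [braid, map_zpow, braidHom, BraidGroup.lift_gen _ _ _ h]
  cases s
  · simp [BraidSign.toInt, crossing]
  · simp only [BraidSign.toInt, zpow_neg, zpow_one]
    rfl

theorem braid_gen_pos {n i : ℕ} (h : i + 1 < n) :
    (braid n (BraidGroup.gen n i) : A) = raise i (C BraidSign.pos) := by
  simpa [BraidSign.toInt] using braid_gen (A := A) h BraidSign.pos

/-- Induction over a braid: generators, products and inverses. -/
theorem _root_.BraidGroup.induction {n : ℕ} {p : BraidGroup n → Prop}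
    (gen : ∀ i, i + 1 < n → p (BraidGroup.gen n i)) (one : p 1)
    (mul : ∀ s t, p s → p t → p (s * t)) (inv : ∀ s, p s → p s⁻¹) (s : BraidGroup n) : p s := by
  have key : s ∈ Subgroup.closure (Set.range (PresentedGroup.of (rels := braidRels n))) := by
    rw [PresentedGroup.closure_range_of]; trivial
  induction key using Subgroup.closure_induction with
  | mem x hx =>
    obtain ⟨⟨i, hi⟩, rfl⟩ := hx
    have h : i + 1 < n := by omega
    have := gen i h
    rwa [BraidGroup.gen, dif_pos h] at this
  | one => exact one
  | mul x y _ _ hx hy => exact mul x y hx hy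
  | inv x _ hx => exact inv x hx

theorem hasArity_raise_C (s : BraidSign) {i n : ℕ} (h : i + 1 < n) :
    HasArity n n (raise i (C s) : A) := by
  have := ((hasArity_C (A := A) s).map_raise i).add (n - (i + 2))
  rwa [show i + 2 + (n - (i + 2)) = n by omega] at this

theorem hasArity_braid {n : ℕ} (s : BraidGroup n) : HasArity n n (braid n s : A) := by
  -- Both directions are carried along, so that the inversion case of the induction is a mere swap.
  suffices HasArity n n (braid n s : A) ∧ HasArity n n (braid n s⁻¹ : A) from this.1
  induction s using BraidGroup.induction with
  | gen i h =>
    have e := braid_gen (A := A) h BraidSign.neg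
    rw [BraidSign.toInt, zpow_neg, zpow_one] at e
    rw [e, braid_gen_pos h]
    exact ⟨hasArity_raise_C _ h, hasArity_raise_C _ h⟩
  | one => simpa [braid_one] using HasArity.one (A := A) n
  | mul s t hs ht =>
    rw [mul_inv_rev, braid_mul, braid_mul]
    exact ⟨ht.1.mul hs.1, hs.2.mul ht.2⟩
  | inv s hs => simpa [and_comm] using hs

theorem braid_shift {o n N : ℕ} (h : o + n ≤ N) (s : BraidGroup n) :
    (braid N (BraidGroup.shift o n N h s) : A) = raise o (braid n s) := by
  induction s using BraidGroup.induction with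
  | gen i hi =>
    rw [BraidGroup.shift, BraidGroup.lift_gen _ _ _ hi, braid_gen_pos hi,
      braid_gen_pos (by omega), raise_raise]
  | one => simp [braid_one]
  | mul s t hs ht => rw [map_mul, braid_mul, hs, ht, braid_mul, map_mul]
  | inv s hs =>
    have h1 : (braid N (BraidGroup.shift o n N h s⁻¹) * braid N (BraidGroup.shift o n N h s) : A)
        = 1 := by rw [map_inv, braid_inv_mul]
    have h2 : (raise o (braid n s) * raise o (braid n s⁻¹) : A) = 1 := by
      rw [← map_mul, braid_mul_inv, map_one]
    rw [hs] at h1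
    exact left_inv_eq_right_inv h1 h2

theorem _root_.BraidGroup.offset_zero {k : ℕ} (j : Fin k → ℕ) : BraidGroup.offset j 0 = 0 := by
  simp [BraidGroup.offset]

theorem _root_.BraidGroup.offset_succ_eq {k : ℕ} (j : Fin (k + 1) → ℕ) (i : ℕ) :
    BraidGroup.offset j (i + 1) = j 0 + BraidGroup.offset (fun l => j l.succ) i := by
  simp [BraidGroup.offset, Fin.sum_univ_succ]

/-- The start `o`, the total `N` and the positions `off` are kept free so that the induction can
pass to the later blocks without transporting braids between groups. -/
theorem braid_prod_shift {k : ℕ} {j : Fin k → ℕ} (t : ∀ i, BraidGroup (j i)) {g : Fin k → A}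
    (hg : ∀ i, HasArity 1 (j i) (g i)) {N o : ℕ} (off : Fin k → ℕ)
    (hoff : ∀ i : Fin k, off i = o + BraidGroup.offset j i) (h : ∀ i, off i + j i ≤ N) :
    braid N (List.ofFn fun m => BraidGroup.shift (off m) (j m) N (h m) (t m)).prod *
        raise o (parallel (List.ofFn g)) =
      raise o (parallel (List.ofFn fun i => braid (j i) (t i) * g i)) := by
  induction k generalizing o with
  | zero => simp [braid_one]
  | succ k ih =>
    have e := ih (fun i => t i.succ) (fun i => hg i.succ) (o := o + j 0) (fun i => off i.succ)
      (fun i => by rw [hoff, Fin.val_succ, BraidGroup.offset_succ_eq, add_assoc])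
      (fun i => h i.succ)
    have h0 : off 0 = o := by rw [hoff, Fin.val_zero, BraidGroup.offset_zero, add_zero]
    rw [List.ofFn_succ, List.prod_cons, braid_mul, braid_shift, List.ofFn_succ, parallel,
      List.ofFn_succ, parallel, (hg 0).mul_raise, mul_assoc (braid (j 0) (t 0)), (hg 0).mul_raise,
      ← mul_assoc (braid (j 0) (t 0)), (hasArity_braid (t 0)).mul_raise, map_mul, map_mul, map_mul,
      raise_raise, raise_raise, ← e, h0, mul_assoc, mul_assoc, mul_assoc,
      ← mul_assoc (raise o (braid _ _)), (hasArity_braid (t 0)).commute _ le_rfl]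
    simp only [mul_assoc]

theorem braid_directSum {k : ℕ} {j : Fin k → ℕ} (t : ∀ i, BraidGroup (j i)) {g : Fin k → A}
    (hg : ∀ i, HasArity 1 (j i) (g i)) :
    braid _ (BraidGroup.directSum t) * parallel (List.ofFn g) =
      parallel (List.ofFn fun i => braid (j i) (t i) * g i) := by
  have := braid_prod_shift t hg (o := 0) (fun i => BraidGroup.offset j i) (fun i => by simp)
    (BraidGroup.offset_add_le j)
  rwa [raise_zero, raise_zero] at this

/-! ### Crossings of parallel strands -/

variable (A) in
/-- One strand crossing `q` strands. -/
def strandMove : ℕ → A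
  | 0 => 1
  | q + 1 => strandMove q * raise q (C BraidSign.pos)

variable (A) in
/-- `p` parallel strands crossing `q` strands. -/
def blockMove : ℕ → ℕ → A
  | 0, _ => 1
  | p + 1, q => raise 1 (blockMove p q) * strandMove A q

theorem strandMove_succ_right (q : ℕ) :
    strandMove A (q + 1) = strandMove A q * raise q (C BraidSign.pos) := rfl

theorem strandMove_succ (q : ℕ) :
    strandMove A (q + 1) = C BraidSign.pos * raise 1 (strandMove A q) := by
  induction q with
  | zero => simp [strandMove, raise_zero]
  | succ q ih =>
    rw [strandMove_succ_right (q + 1), ih, map_mul, raise_raise, mul_assoc, add_comm q 1, ← raise_raise 1 q, ← map_mul,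
      ← strandMove_succ_right, ih, map_mul, raise_raise]

theorem hasArity_strandMove (q : ℕ) : HasArity (q + 1) (q + 1) (strandMove A q) := by
  induction q with
  | zero => exact HasArity.one 1
  | succ q ih => exact (ih.add 1).mul ((hasArity_C BraidSign.pos).map_raise q)

theorem braid_strandCross {N o q : ℕ} (h : o + q < N) :
    (braid N (BraidGroup.strandCross N o q) : A) = raise o (strandMove A q) := by
  induction q with
  | zero => simp [BraidGroup.strandCross, strandMove, braid_one]
  | succ q ih =>
    rw [BraidGroup.strandCross, braid_mul, ih (by omega), braid_gen_pos (by omega), strandMove,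
      map_mul, raise_raise]

theorem braid_blockCross {N o p q : ℕ} (h : o + p + q ≤ N) :
    (braid N (BraidGroup.blockCross N o p q) : A) = raise o (blockMove A p q) := by
  induction p generalizing o with
  | zero => simp [BraidGroup.blockCross, blockMove, braid_one]
  | succ p ih =>
    rw [BraidGroup.blockCross, braid_mul, ih (by omega), braid_strandCross (by omega), blockMove,
      map_mul, raise_raise]

/-! ### Operators passing through crossings -/

theorem raise_bullet_mul_C (a : A) (s : BraidSign) : raise 1 (bullet a) * C s = bullet a := by
  rw [← bullet_mul_C s.flip, mul_assoc, C_flip_mul_C, mul_one]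

/-- The second hexagon: axiom `bc` for `C⁻`, with the negative crossings moved to the other side by
inversion. -/
theorem B_mul_C : (B : A) * C BraidSign.pos =
    raise 1 (C BraidSign.pos) * (C BraidSign.pos * raise 1 B) := by
  have h := raise_B_mul_C (A := A) BraidSign.neg
  have c : (C BraidSign.pos * C BraidSign.neg : A) = 1 := cox₁ BraidSign.pos
  have d : (C BraidSign.neg * C BraidSign.pos : A) = 1 := cox₁ BraidSign.neg
  have e : (raise 1 (C BraidSign.pos) * raise 1 (C BraidSign.neg) : A) = 1 := by
    rw [← map_mul, c, map_one]
  have h' : (C BraidSign.pos * raise 1 B : A) = raise 1 (C BraidSign.neg) * B * C BraidSign.pos := by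
    calc (C BraidSign.pos * raise 1 B : A)
        = C BraidSign.pos * (raise 1 B * C BraidSign.neg) * C BraidSign.pos := by
          rw [mul_assoc, mul_assoc, d, mul_one]
      _ = (C BraidSign.pos * C BraidSign.neg) * (raise 1 (C BraidSign.neg) * B) *
            C BraidSign.pos := by rw [h]; simp only [mul_assoc]
      _ = _ := by rw [c, one_mul]
  rw [h', ← mul_assoc, ← mul_assoc, e, one_mul]

theorem raise_B_pow_mul_C (q : ℕ) :
    raise 1 (B ^ q : A) * C BraidSign.pos = strandMove A (q + 1) * B ^ q := by
  induction q with
  | zero => simp [strandMove, raise_zero]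
  | succ q ih =>
    have h := (hasArity_B_pow (A := A) q).mul_raise (C BraidSign.pos)
    rw [pow_succ, map_mul, mul_assoc, raise_B_mul_C, ← mul_assoc, ih, mul_assoc, ← mul_assoc (B ^ q),
      h, strandMove_succ_right (q + 1), strandMove_succ_right]
    simp only [mul_assoc]

/-- In canonical form the factor `B ^ q` replaces the one crossing by `q + 1` crossings, and the
bullet absorbs the first of them. -/
theorem HasArity.raise_mul_C {q : ℕ} {g : A} (h : HasArity 1 q g) :
    raise 1 g * C BraidSign.pos = strandMove A q * g := by
  rw [h.eq_bullet, map_mul, mul_assoc, raise_B_pow_mul_C, strandMove_succ]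
  simp only [← mul_assoc]
  rw [raise_bullet_mul_C, bullet_mul_raise]

theorem bullet_mul_strandMove (a : A) (q : ℕ) :
    bullet a * strandMove A q = raise q (bullet a) := by
  induction q with
  | zero => rw [strandMove, mul_one, raise_zero]
  | succ q ih =>
    rw [strandMove_succ, ← mul_assoc, bullet_mul_C, ← map_mul, ih, raise_raise, add_comm]

/-- Duplicating the strand that crosses `q` others: `B_mul_C` at each crossing, regrouped by far
commutativity. -/
theorem B_mul_strandMove (q : ℕ) :
    B * strandMove A q = raise 1 (strandMove A q) * (strandMove A q * raise q B) := by
  induction q with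
  | zero => simp [strandMove, raise_zero]
  | succ q ih =>
    calc B * strandMove A (q + 1)
        = raise 1 (strandMove A q) * strandMove A q * raise q (B * C BraidSign.pos) := by
          rw [strandMove, ← mul_assoc, ih, map_mul]; simp only [mul_assoc]
      _ = raise 1 (strandMove A q) * (strandMove A q * raise (q + 1) (C BraidSign.pos)) *
            raise q (C BraidSign.pos) * raise (q + 1) B := by
          rw [B_mul_C, map_mul, map_mul, raise_raise, raise_raise]; simp only [mul_assoc]
      _ = _ := by
          rw [(hasArity_strandMove q).mul_raise, strandMove, map_mul, raise_raise, add_comm 1 q]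
          simp only [mul_assoc]

theorem B_pow_mul_strandMove (p q : ℕ) :
    B ^ p * strandMove A q = blockMove A (p + 1) q * raise q (B ^ p) := by
  induction p with
  | zero => simp [blockMove]
  | succ p ih =>
    calc B ^ (p + 1) * strandMove A q
        = B * raise 1 (blockMove A p q) * strandMove A q * raise q (B ^ p) := by
          rw [pow_succ', mul_assoc, ih, blockMove]; simp only [mul_assoc]
      _ = raise 2 (blockMove A p q) * (B * strandMove A q) * raise q (B ^ p) := by
          rw [B_mul_raise]; simp only [mul_assoc]
      _ = _ := by
          rw [B_mul_strandMove, blockMove, blockMove, pow_succ', map_mul, map_mul, raise_raise]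
          simp only [mul_assoc]

theorem HasArity.mul_strandMove {p : ℕ} {f : A} (h : HasArity 1 p f) (q : ℕ) :
    f * strandMove A q = blockMove A p q * raise q f := by
  rw [h.eq_bullet, mul_assoc, B_pow_mul_strandMove, blockMove, map_mul]
  simp only [← mul_assoc]
  rw [bullet_mul_raise, mul_assoc (blockMove A p q), bullet_mul_strandMove]

/-- Naturality of the braiding in both variables: first `g` goes through the crossing, producing `q`
crossings, then `f` multiplies the crossing strand by `p`. -/
theorem HasArity.mul_raise_mul_C {p q : ℕ} {f g : A} (hf : HasArity 1 p f) (hg : HasArity 1 q g) :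
    f * raise 1 g * C BraidSign.pos = blockMove A p q * (g * raise 1 f) := by
  rw [mul_assoc, hg.raise_mul_C, ← mul_assoc, hf.mul_strandMove, mul_assoc, hg.mul_raise]

/-! ### Equivariance -/

theorem offset_eq_sum {i r : ℕ} (j : Fin (i + r) → ℕ) :
    BraidGroup.offset j i = ∑ l : Fin i, j (Fin.castAdd r l) := by
  simp [BraidGroup.offset, Fin.sum_univ_add]

theorem ofFn_split {α : Type*} {i r : ℕ} (g : Fin (i + (r + 1 + 1)) → α) :
    List.ofFn g = (List.ofFn fun m => g (Fin.castAdd _ m)) ++ g (Fin.natAdd i 0) ::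
      g (Fin.natAdd i (Fin.succ 0)) :: List.ofFn fun m => g (Fin.natAdd i m.succ.succ) := by
  refine List.ofFn_add.trans ?_
  rw [List.ofFn_succ, List.ofFn_succ]
  rfl

theorem parallel_mul_raise_C {k N i : ℕ} (h : i + 1 < k) (j : BraidGroup.BlockSizes k N) {g : Fin k → A}
    (hg : ∀ m, HasArity 1 (j.1 m) (g m)) :
    parallel (List.ofFn g) * raise i (C BraidSign.pos) =
      braid N (BraidGroup.cableGen i j) *
        parallel (List.ofFn fun m => g ((BraidGroup.adjSwap k i).symm m)) := by
  obtain ⟨r, rfl⟩ : ∃ r, k = i + (r + 1 + 1) := ⟨k - i - 2, by omega⟩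
  have hsymm : ∀ m, (BraidGroup.adjSwap (i + (r + 1 + 1)) i).symm m =
      BraidGroup.adjSwap (i + (r + 1 + 1)) i m := fun m => by
    rw [BraidGroup.adjSwap, dif_pos h, Equiv.symm_swap]
  have s0 : ∀ m : Fin i, BraidGroup.adjSwap (i + (r + 1 + 1)) i (Fin.castAdd _ m) =
      Fin.castAdd _ m := fun m => by
    have := m.2
    ext
    rw [BraidGroup.adjSwap_val h, Fin.val_castAdd, if_neg (by omega), if_neg (by omega)]
  have s1 : BraidGroup.adjSwap (i + (r + 1 + 1)) i (Fin.natAdd i 0) =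
      Fin.natAdd i (Fin.succ 0) := by
    ext
    rw [BraidGroup.adjSwap_val h]
    simp
  have s2 : BraidGroup.adjSwap (i + (r + 1 + 1)) i (Fin.natAdd i (Fin.succ 0)) =
      Fin.natAdd i 0 := by
    ext
    rw [BraidGroup.adjSwap_val h]
    simp
  have s3 : ∀ m : Fin r, BraidGroup.adjSwap (i + (r + 1 + 1)) i
      (Fin.natAdd i m.succ.succ) = Fin.natAdd i m.succ.succ := fun m => by
    ext
    rw [BraidGroup.adjSwap_val h, if_neg (by simp), if_neg (by simp)]
  have hP := hasArity_parallel (fun m : Fin i => hg (Fin.castAdd _ m))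
  rw [← offset_eq_sum] at hP
  have ha : j.size i = j.1 (Fin.natAdd i 0) := by
    rw [BraidGroup.BlockSizes.size, dif_pos (by omega)]; rfl
  have hb : j.size (i + 1) = j.1 (Fin.natAdd i (Fin.succ 0)) := by
    rw [BraidGroup.BlockSizes.size, dif_pos h]; rfl
  have hle : BraidGroup.offset j.1 i + j.size i + j.size (i + 1) ≤ N := by
    rw [← BraidGroup.offset_succ_size j (by omega), ← BraidGroup.offset_succ_size j h]
    exact (BraidGroup.offset_le _ _).trans j.2.le
  have key := (hg (Fin.natAdd i 0)).mul_raise_mul_C (hg (Fin.natAdd i (Fin.succ 0)))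
  rw [BraidGroup.cableGen, braid_blockCross hle, ha, hb]
  simp only [hsymm, ofFn_split, s0, s1, s2, s3, parallel_append, parallel,
    List.length_ofFn]
  -- The first `i` operators form a morphism from `i` to `offset j.1 i`, so the block crossing
  -- slides through them and they cancel from both sides.
  rw [← mul_assoc, ← hP.mul_raise, mul_assoc, mul_assoc]
  simp only [← map_mul]
  congr 2
  -- The operators after the two crossed ones are raised by 2, so `C⁺` commutes with them and
  -- reaches the adjacent pair.
  rw [map_mul, raise_raise, mul_assoc, mul_assoc, ← C_mul_raise, ← mul_assoc, ← mul_assoc, key]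
  simp only [map_mul, raise_raise, mul_assoc]

/-- Cabling is a cocycle (`BraidGroup.cable_mul`), so the identity for generators extends to
products and inverses. -/
theorem parallel_mul_braid {k N : ℕ} (s : BraidGroup k) (j : BraidGroup.BlockSizes k N) {g : Fin k → A}
    (hg : ∀ m, HasArity 1 (j.1 m) (g m)) :
    parallel (List.ofFn g) * braid k s =
      braid N (BraidGroup.cableHom k N s (j, 1)).2 *
        parallel (List.ofFn fun m => g ((BraidGroup.toPerm k s)⁻¹ m)) := by
  induction s using BraidGroup.induction generalizing j g with
  | gen i h =>
    rw [braid_gen_pos h, parallel_mul_raise_C h j hg, BraidGroup.cableHom, BraidGroup.lift_gen _ _ _ h,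
      BraidGroup.toPerm, BraidGroup.lift_gen _ _ _ h]
    simp [BraidGroup.cablePerm]
  | one => simp [braid_one]
  | mul s t hs ht =>
    rw [braid_mul, ← mul_assoc, ht j hg, mul_assoc,
      hs (j.permute (BraidGroup.toPerm k t)) 
        (g := fun m => g ((BraidGroup.toPerm k t)⁻¹ m)) (fun m => hg _), BraidGroup.cable_mul, braid_mul,
      mul_assoc, map_mul, mul_inv_rev]
    rfl
  | inv s hs =>
    -- The hypothesis for `s` is used on operators permuted in advance so that `s` restores their
    -- order; the cocycle rule for `s s⁻¹` shows that the cable of `s⁻¹` inverts the one occurring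
    -- here.
    have e := hs (j.permute (BraidGroup.toPerm k s)⁻¹)
      (g := fun m => g (((BraidGroup.toPerm k s)⁻¹).symm m)) (fun m => hg _)
    have c := BraidGroup.cable_mul s s⁻¹ j
    rw [mul_inv_cancel, map_inv, map_one, Equiv.Perm.one_apply] at c
    have c' := eq_inv_of_mul_eq_one_right c.symm
    have hp : (fun m => g (((BraidGroup.toPerm k s)⁻¹).symm ((BraidGroup.toPerm k s)⁻¹ m))) = g := by
      funext m
      rw [Equiv.symm_apply_apply]
    rw [hp] at e
    rw [c', map_inv, inv_inv]
    calc parallel (List.ofFn g) * braid k s⁻¹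
        = braid N ((BraidGroup.cableHom k N s (j.permute (BraidGroup.toPerm k s)⁻¹, 1)).2)⁻¹ *
            (braid N ((BraidGroup.cableHom k N s (j.permute (BraidGroup.toPerm k s)⁻¹, 1)).2) *
              parallel (List.ofFn g)) * braid k s⁻¹ := by
          rw [← mul_assoc (braid N _), braid_inv_mul, one_mul]
      _ = _ := by
          rw [← e, mul_assoc, mul_assoc, braid_mul_inv, mul_one]
          rfl

/-! ### The internal operad -/

theorem hasArity_coe {m : ℕ} (x : internalOps A m) : HasArity 1 m (x : A) := mem_internalOps.1 x.2

theorem internalOps_ext {m : ℕ} {x y : internalOps A m} (h : (x : A) ⬝ 1 = (y : A) ⬝ 1) : x = y := by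
  apply Subtype.ext
  rw [(hasArity_coe x).eq_bullet, (hasArity_coe y).eq_bullet, h]

theorem parallel_mul_mem {n : ℕ} (g : internalOps A n) {k : Fin n → ℕ}
    (f : ∀ i, internalOps A (k i)) :
    parallel (List.ofFn fun i => (f i : A)) * g ∈ internalOps A (∑ i, k i) :=
  mem_internalOps.2 ((hasArity_parallel fun i => hasArity_coe (f i)).mul (hasArity_coe g))

variable (A) in
/-- The operad structure on the internal operators of a `BC±I`-algebra. -/
def planarOperad : PlanarOperad (fun m => internalOps A m) where
  one := ⟨1, mem_internalOps.2 (HasArity.one 1)⟩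
  comp g _ f := ⟨parallel (List.ofFn fun i => (f i : A)) * g, parallel_mul_mem g f⟩
  comp_one f := by
    apply Subtype.ext
    rw [coe_castArity]
    simp only [List.ofFn_const, parallel_replicate_one, one_mul]
  one_comp f := by
    apply Subtype.ext
    rw [coe_castArity]
    simp [parallel]
  assoc h k g l f := by
    apply Subtype.ext
    rw [coe_castArity]
    simp only
    rw [parallel_mul (fun i => List.ofFn fun a => (f i a : A))
      (fun i => by simpa using hasArity_coe (g i)), List.ofFn_finSigma, mul_assoc]
    congr 4
    funext i
    congr 1
    funext a
    rw [Equiv.symm_apply_apply]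

variable (A) in
/-- The braided operad structure on the internal operators of a `BC±I`-algebra. -/
def braidedOperad : BraidedOperad (fun m => internalOps A m) where
  toPlanarOperad := planarOperad A
  act f s := ⟨braid _ s * f, mem_internalOps.2 ((hasArity_braid s).mul (hasArity_coe f))⟩
  act_one f := by
    apply Subtype.ext
    simp only [braid_one, one_mul]
  act_mul f s t := by
    apply Subtype.ext
    simp only [braid_mul, mul_assoc]
  act_comp f s j g := by
    apply Subtype.ext
    simp only [planarOperad, coe_castArity]
    rw [← mul_assoc, parallel_mul_braid s ⟨j, rfl⟩ (fun m => hasArity_coe (g m)), mul_assoc]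
    rfl
  comp_act f j g t := by
    apply Subtype.ext
    simp only [planarOperad]
    rw [← mul_assoc, braid_directSum t fun i => hasArity_coe (g i)]

theorem coe_comp₂ (f : internalOps A 2) {m n : ℕ} (x : internalOps A m) (y : internalOps A n) :
    ((planarOperad A).comp₂ f x y : A) = x * (raise 1 (y : A) * f) := by
  rw [PlanarOperad.comp₂, coe_castArity]
  simp only [planarOperad]
  rw [List.ofFn_succ, List.ofFn_succ, List.ofFn_zero, parallel, parallel, parallel, map_one, mul_one,
    mul_assoc]
  rfl

variable (A) in
/-- The closed braided operad structure on the internal operators of a `BC±I`-algebra. -/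
def closedBraidedOperad : ClosedBraidedOperad (fun m => internalOps A m) where
  toBraidedOperad := braidedOperad A
  app := ⟨B, mem_internalOps.2 hasArity_B⟩
  lam {m} t := ⟨bullet ((t : A) ⬝ 1) * B ^ m, mem_internalOps.2 (hasArity_bullet_mul_pow _ m)⟩
  app_lam p := by
    apply Subtype.ext
    refine (coe_comp₂ _ _ _).trans ?_
    simp only [braidedOperad, planarOperad, map_one, one_mul]
    -- `app(q, id)` is `q ∘ B`, so the abstraction is the canonical form of `p` with one `B`
    -- removed.
    rw [mul_assoc, ← pow_succ, ← (hasArity_coe p).eq_bullet]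
  lam_unique p q h := by
    subst h
    apply internalOps_ext
    rw [bullet_mul_pow_app_one]
    refine Eq.trans ?_ (congrArg (· ⬝ (1 : A)) (coe_comp₂ _ _ _)).symm
    simp only [braidedOperad, planarOperad, map_one, one_mul, mul_app]
    -- As `B I = I`, the elements `q ∘ B` and `q` agree at `I`, which determines `q`.
    rw [← raise_one, map_one]

/-- `a ↦ a^•` is a bijection onto the nullary operators. -/
def bulletEquiv : A ≃ internalOps A 0 where
  toFun a := ⟨bullet a, mem_internalOps.2 (hasArity_bullet a)⟩
  invFun x := (x : A) ⬝ 1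
  left_inv a := by
    have := bullet_mul_pow_app_one a 0
    rwa [pow_zero, mul_one] at this
  right_inv x := by
    apply Subtype.ext
    have := (hasArity_coe x).eq_bullet
    rw [pow_zero, mul_one] at this
    exact this.symm

/-! ### The algebra of nullary operators -/

theorem coe_lam {m : ℕ} (t : internalOps A (m + 1)) :
    ((closedBraidedOperad A).lam t : A) = bullet ((t : A) ⬝ 1) * B ^ m := rfl

/-- Abstraction preserves the value at `I`, so iterated abstractions are computed from the innermost
operator. -/
theorem lam_app_one {m : ℕ} (t : internalOps A (m + 1)) :
    ((closedBraidedOperad A).lam t : A) ⬝ 1 = (t : A) ⬝ 1 :=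
  bullet_mul_pow_app_one _ m

theorem coe_lam_zero (t : internalOps A 1) :
    ((closedBraidedOperad A).lam t : A) = bullet ((t : A) ⬝ 1) := by
  rw [coe_lam, pow_zero, mul_one]

variable (A) in
/-- A `BC±I`-algebra is isomorphic to the nullary operators of its internal operad. -/
def nullaryIso : @BCIIso A (internalOps A 0) _ (closedBraidedOperad A).nullary := by
  refine @BCIIso.mk A (internalOps A 0) _ (closedBraidedOperad A).nullary bulletEquiv
    (fun a b => ?_) ?_ (fun s => ?_) ?_
  · apply Subtype.ext
    refine Eq.trans ?_ (coe_comp₂ _ _ _).symm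
    change bullet (a ⬝ b) = bullet a * (raise 1 (bullet b) * B)
    rw [bullet_app, ← mul_assoc, ← mul_assoc, bullet_mul_raise]
  · apply Subtype.ext
    refine Eq.trans ?_ (coe_lam_zero _).symm
    rw [lam_app_one, lam_app_one]
    refine congrArg bullet (Eq.symm ((congrArg (· ⬝ (1 : A)) (coe_comp₂ _ _ _)).trans ?_))
    change ((1 : A) * (raise 1 B * B)) ⬝ 1 = B
    rw [one_mul, mul_app, raise_one, B_app_app, ← raise_one, map_one, mul_one]
  · apply Subtype.ext
    refine Eq.trans ?_ (coe_lam_zero _).symm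
    rw [lam_app_one, lam_app_one]
    refine congrArg bullet (Eq.symm ?_)
    change (braid 3 (BraidGroup.gen 3 1 ^ s.toInt) * _) ⬝ 1 = C s
    rw [braid_gen (by omega)]
    have e : ∀ x y z : internalOps A 1, (x : A) = 1 → (y : A) = 1 → (z : A) = 1 →
        ((planarOperad A).comp₂ ⟨B, mem_internalOps.2 hasArity_B⟩
          ((planarOperad A).comp₂ ⟨B, mem_internalOps.2 hasArity_B⟩ x y) z : A) = B * B := by
      intro x y z hx hy hz
      rw [coe_comp₂, coe_comp₂, hx, hy, hz, map_one, one_mul, one_mul]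
    refine (congrArg (fun w : A => (raise 1 (C s) * w) ⬝ 1) (e _ _ _ rfl rfl rfl)).trans ?_
    have h : (B : A) ⬝ 1 = 1 := by rw [← raise_one, map_one]
    -- At `I` the two factors `B` disappear, and what remains is `B (C s) I = C s ∘ I`.
    rw [mul_app, mul_app, h, h, raise_one, B_app_app, mul_one]
  · apply Subtype.ext
    refine Eq.trans ?_ (coe_lam_zero _).symm
    exact congrArg bullet (one_app (A := A) 1).symm

end ExtensionalBCI

open BCISignature in
theorem mainTheorem5 (A : Type u) [BCISignature A] [ExtensionalBCI A] :
    ∃ O : ClosedBraidedOperad (fun m => internalOps A m),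
      (O.one : A) = I ∧
      (∀ (n : ℕ) (g : internalOps A n) (k : Fin n → ℕ) (f : ∀ i, internalOps A (k i)),
        (O.comp g f : A) = compFrom 0 (List.ofFn fun i => (f i : A)) g) ∧
      (∀ (n i : ℕ) (_ : i + 1 < n) (s : BraidSign) (f : internalOps A n),
        (O.act f (BraidGroup.gen n i ^ s.toInt) : A) = (Bpow i ⬝ C s) ⊚ (f : A)) ∧
      (O.app : A) = B ∧
      (∀ (m : ℕ) (t : internalOps A (m + 1)),
        (O.lam t : A) = bullet ((t : A) ⬝ I) ⊚ Bpow m) ∧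
      ∃ e : @BCIIso A (internalOps A 0) _ O.nullary,
        ∀ a : A, (e.toFun a : A) = bullet a := by
  refine ⟨ExtensionalBCI.closedBraidedOperad A, rfl, fun n g k f => ?_, fun n i h s f => ?_, rfl,
    fun m t => ?_, ExtensionalBCI.nullaryIso A, fun a => rfl⟩
  · rw [ExtensionalBCI.compFrom_eq, ExtensionalBCI.raise_zero]
    rfl
  · rw [ExtensionalBCI.Bpow_app, ExtensionalBCI.circ_eq_mul, ← ExtensionalBCI.braid_gen h]
    rfl
  · rw [ExtensionalBCI.Bpow_eq_pow]
    rfl
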